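/- Let $\mathcal{H}$ be the complex upper half plane and $\mathrm{Hol}$ the $\mathbb{C}$-algebra of holomorphic functions on $\mathcal{H}$. Put $H_n=\mathrm{Hol}$ for every $n\in\mathbb{R}$ and $H=\bigoplus_{n\in\mathbb{R}}H_n$, and write $(f,n)$ for $f\in\mathrm{Hol}$ regarded as an element of $H_n$. For $i\in\mathbb{R}$ let $\mathrm{End}^i(H)$ be the space of $\mathbb{C}$-linear maps $\phi:H\to H$ with $\phi(H_n)\subset H_{n+i}$ for all $n\in\mathbb{R}$, and let $\mathrm{End}(H)=\bigoplus_{i\in\mathbb{R}}\mathrm{End}^i(H)$, a $\mathbb{C}$-algebra under composition. Let $E_k=1+O(q)$, $q=e^{2\pi i z}$, be the normalized Eisenstein series of weight $k$ for $\mathrm{SL}(2,\mathbb{Z})$ ($k=2,4,6$), and for $n\in\mathbb{R}$ let $D_nf=\frac{1}{2\pi i}\frac{df}{dz}-\frac{n}{12}E_2f$ for $f\in\mathrm{Hol}$. Let $\delta\in\mathrm{End}^2(H)$, $e_4\in\mathrm{End}^4(H)$ and $e_6\in\mathrm{End}^6(H)$ be the linear maps given by $$\delta(f,n)=(D_nf,n+2),\qquad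 e_4(f,n)=(E_4f,n+4),\qquad e_6(f,n)=(E_6f,n+6),$$ and let $\mathcal{R}$ be the (unital) $\mathbb{C}$-subalgebra of $\mathrm{End}(H)$ generated by $\delta$, $e_4$ and $e_6$. Theorem. The family $(e_4^i e_6^j\delta^k)_{i,j,k\in\mathbb{Z}_{\ge0}}$ is a $\mathbb{C}$-basis of $\mathcal{R}$. -/

import Mathlib

open scoped Manifold DirectSum

noncomputable section

namespace MLDO

/-- The algebra `Hol` of holomorphic functions on the upper half plane. -/
def Hol : Subalgebra ℂ (UpperHalfPlane → ℂ) where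
  carrier := {f | MDiff f}
  mul_mem' hf hg := MDifferentiable.mul hf hg
  add_mem' hf hg := MDifferentiable.add hf hg
  algebraMap_mem' _ := mdifferentiable_const

/-- The space `H = ⨁_{n ∈ ℝ} H_n` with `H_n = Hol` for every `n`. -/
def H : Type := ⨁ _ : ℝ, Hol

instance : AddCommGroup H := inferInstanceAs (AddCommGroup (⨁ _ : ℝ, Hol))

instance : Module ℂ H := inferInstanceAs (Module ℂ (⨁ _ : ℝ, Hol))

/-- The element `(f, n)` of `H`, that is `f` viewed in `H_n`, as a linear map in `f`. -/
def inc (n : ℝ) : Hol →ₗ[ℂ] H := DirectSum.lof ℂ ℝ (fun _ => Hol) n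

/-- The component in `H_n` of an element of `H`. -/
def comp (n : ℝ) : H →ₗ[ℂ] Hol := DirectSum.component ℂ ℝ (fun _ => Hol) n

/-- The linear map on `H` that is given by `φ n` on `H_n`. -/
def liftH {V : Type} [AddCommGroup V] [Module ℂ V] (φ : ℝ → Hol →ₗ[ℂ] V) : H →ₗ[ℂ] V :=
  DirectSum.toModule ℂ ℝ V φ

@[simp]
lemma comp_inc_self (n : ℝ) (f : Hol) : comp n (inc n f) = f :=
  DirectSum.component.lof_self ℂ (M := fun _ : ℝ => Hol) n f

lemma comp_inc_of_ne {m n : ℝ} (h : m ≠ n) (f : Hol) : comp m (inc n f) = 0 :=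
  DirectSum.of_eq_of_ne (β := fun _ : ℝ => Hol) n m f h

@[simp]
lemma liftH_inc {V : Type} [AddCommGroup V] [Module ℂ V] (φ : ℝ → Hol →ₗ[ℂ] V) (n : ℝ) (f : Hol) :
    liftH φ (inc n f) = φ n f :=
  DirectSum.toModule_lof ℂ (M := fun _ : ℝ => Hol) n f

lemma hom_ext {V : Type} [AddCommGroup V] [Module ℂ V] {φ ψ : H →ₗ[ℂ] V}
    (h : ∀ n f, φ (inc n f) = ψ (inc n f)) : φ = ψ :=
  DirectSum.linearMap_ext ℂ fun n => LinearMap.ext (h n)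

/-- The subspace `H_n` of `H`. -/
def Hn (n : ℝ) : Submodule ℂ H := LinearMap.range (inc n)

/-- `End^i(H)`: the linear endomorphisms of `H` that map `H_n` into `H_{n+i}` for all `n`. -/
def EndDeg (i : ℝ) : Submodule ℂ (Module.End ℂ H) where
  carrier := {φ | ∀ n : ℝ, ∀ x ∈ Hn n, φ x ∈ Hn (n + i)}
  add_mem' hφ hψ n x hx := Submodule.add_mem _ (hφ n x hx) (hψ n x hx)
  zero_mem' _ _ _ := Submodule.zero_mem _
  smul_mem' c _ hφ n x hx := Submodule.smul_mem _ c (hφ n x hx)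

lemma one_mem_EndDeg : (1 : Module.End ℂ H) ∈ EndDeg 0 := fun n x hx => by
  simpa using hx

lemma mul_mem_EndDeg {i j : ℝ} {φ ψ : Module.End ℂ H} (hφ : φ ∈ EndDeg i) (hψ : ψ ∈ EndDeg j) :
    φ * ψ ∈ EndDeg (i + j) := fun n x hx => by
  have h := hφ _ _ (hψ n x hx)
  rwa [add_assoc, add_comm j i] at h

/-- The sum of the `EndDeg i` is direct. -/
lemma iSupIndep_EndDeg : iSupIndep EndDeg := by
  classical
  refine iSupIndep_of_dfinsupp_lsum_injective _ ?_
  refine (injective_iff_map_eq_zero _).2 fun m hm => ?_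
  ext i : 1
  refine Subtype.ext ?_
  refine hom_ext fun n f => ?_
  have key : ∀ j : ℝ, ∃ g : Hol, (m j : Module.End ℂ H) (inc n f) = inc (n + j) g := fun j => by
    obtain ⟨g, hg⟩ := (m j).2 n (inc n f) ⟨f, rfl⟩
    exact ⟨g, hg.symm⟩
  choose g hg using key
  have h0 : (DFinsupp.lsum ℕ (fun i => (EndDeg i).subtype) m) (inc n f) = 0 := by
    rw [hm]; rfl
  rw [DFinsupp.lsum_apply_apply, DFinsupp.sumAddHom_apply, DFinsupp.sum,
    LinearMap.sum_apply] at h0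
  have h1 : ∑ j ∈ m.support, inc (n + j) (g j) = 0 := by
    rw [← h0]
    exact Finset.sum_congr rfl fun j _ => (hg j).symm
  have h2 := congrArg (comp (n + i)) h1
  rw [map_sum, map_zero] at h2
  by_cases hi : i ∈ m.support
  · rw [Finset.sum_eq_single i (fun j _ hj => comp_inc_of_ne (by simpa using hj.symm) _)
      (fun h => absurd hi h), comp_inc_self] at h2
    change (m i : Module.End ℂ H) (inc n f) = 0
    rw [hg, h2, map_zero]
  · have : m i = 0 := by simpa using hi
    rw [this]; rfl

/-- The graded algebra `End(H) = ⨁_{i ∈ ℝ} End^i(H)`, as a subalgebra of the algebra of all linear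
endomorphisms of `H`. -/
def EndH : Subalgebra ℂ (Module.End ℂ H) :=
  (⨆ i, EndDeg i).toSubalgebra (Submodule.mem_iSup_of_mem 0 one_mem_EndDeg) (by
    intro x y hx hy
    have h : (⨆ i, EndDeg i) * (⨆ i, EndDeg i) ≤ ⨆ i, EndDeg i := by
      rw [Submodule.iSup_mul]
      refine iSup_le fun i => ?_
      rw [Submodule.mul_iSup]
      refine iSup_le fun j => Submodule.mul_le.2 fun a ha b hb => ?_
      exact Submodule.mem_iSup_of_mem (i + j) (mul_mem_EndDeg ha hb)
    exact h (Submodule.mul_mem_mul hx hy))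

lemma mem_EndH {i : ℝ} {φ : Module.End ℂ H} (hφ : φ ∈ EndDeg i) : φ ∈ EndH :=
  Submodule.mem_iSup_of_mem (p := EndDeg) i hφ

/-- The Ramanujan-Serre operator `D_n f = (2 π i)⁻¹ f' - (n / 12) E₂ f` on `Hol`. -/
def serreD (n : ℝ) : Hol →ₗ[ℂ] Hol where
  toFun f := ⟨Derivative.serreDerivative n f, Derivative.serreDerivative_mdifferentiable n f.2⟩
  map_add' f g := Subtype.ext (Derivative.serreDerivative_add n f g f.2 g.2)
  map_smul' c f := Subtype.ext (Derivative.serreDerivative_smul n c f f.2)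

/-- The Eisenstein series `E₄ = 1 + O(q)` as an element of `Hol`. -/
def E4 : Hol := ⟨ModularForm.E₄, ModularForm.E₄.holo'⟩

/-- The Eisenstein series `E₆ = 1 + O(q)` as an element of `Hol`. -/
def E6 : Hol := ⟨ModularForm.E₆, ModularForm.E₆.holo'⟩

/-- The endomorphism `(f, n) ↦ (T n f, n + i)` of `H`. -/
def shiftMap (i : ℝ) (T : ℝ → Hol →ₗ[ℂ] Hol) : Module.End ℂ H :=
  liftH fun n => inc (n + i) ∘ₗ T n

lemma shiftMap_inc (i : ℝ) (T : ℝ → Hol →ₗ[ℂ] Hol) (n : ℝ) (f : Hol) :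
    shiftMap i T (inc n f) = inc (n + i) (T n f) := by
  simp [shiftMap]

lemma shiftMap_mem (i : ℝ) (T : ℝ → Hol →ₗ[ℂ] Hol) : shiftMap i T ∈ EndDeg i := by
  rintro n _ ⟨f, rfl⟩
  exact ⟨T n f, (shiftMap_inc i T n f).symm⟩

/-- `δ (f, n) = (D_n f, n + 2)`. -/
def delta : EndH := ⟨shiftMap 2 serreD, mem_EndH (shiftMap_mem 2 _)⟩

/-- `e₄ (f, n) = (E₄ f, n + 4)`. -/
def e4 : EndH :=
  ⟨shiftMap 4 fun _ => LinearMap.mulLeft ℂ E4, mem_EndH (shiftMap_mem 4 _)⟩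

/-- `e₆ (f, n) = (E₆ f, n + 6)`. -/
def e6 : EndH :=
  ⟨shiftMap 6 fun _ => LinearMap.mulLeft ℂ E6, mem_EndH (shiftMap_mem 6 _)⟩

/-- The MLDO algebra `ℛ`: the subalgebra of `End(H)` generated by `δ`, `e₄`, `e₆`. -/
def R : Subalgebra ℂ EndH := Algebra.adjoin ℂ {delta, e4, e6}

end MLDO

end

/-!
Since `D_{m+n} (f g) = (D_m f) g + f D_n g`, the commutator of `δ` with multiplication by a form `f`
of weight `w` is multiplication by the modular form `D_w f` of weight `w + 2`. The spaces of modular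
forms of weights 6 and 8 are lines spanned by `E₆` and `E₄²`, so `[δ, e₄]` is a multiple of `e₆` and
`[δ, e₆]` one of `e₄²`; hence every word in the generators can be reordered with all `δ` on the
right.

For the independence, consider the action on `H_0`. A relation `∑ f_k D^k = 0` with holomorphic
`f_k` and iterated Serre derivatives `D^k`, applied to `(z - z₀) ^ N` with `N` the largest index,
shows that `f_N` vanishes at the arbitrary point `z₀`. It remains to see that `E₄` and `E₆` are
algebraically independent. Since `E₆` vanishes at `i`, it vanishes at `-1 / (n + i)` for all `n`,
where `E₄` takes the infinitely many values `(n + i) ^ 4 E₄(i)`, so `E₆` divides no nonzero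
polynomial in `E₄`.
-/

namespace MLDO

open Polynomial

section Transcendence

variable {K A : Type*} [CommRing K] [CommRing A] [Algebra K A] {x y : A}

lemma transcendental_of_forall_dvd_algebraMap [NoZeroDivisors A] (hy : y ≠ 0)
    (h : ∀ c : K, y ∣ algebraMap K A c → c = 0) : Transcendental K y := by
  refine transcendental_iff.2 fun p => ?_
  induction p using recOnHorner with
  | M0 => exact fun _ => rfl
  | MC p a hp ha _ =>
    intro hpa
    obtain ⟨q, rfl⟩ := X_dvd_iff.2 hp
    refine absurd (h a ?_) ha
    simp only [map_add, map_mul, aeval_X, aeval_C] at hpa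
    exact ⟨-aeval y q, by linear_combination hpa⟩
  | MX p _ ih =>
    intro hpX
    rw [map_mul, aeval_X] at hpX
    rw [ih ((mul_eq_zero.1 hpX).resolve_right hy), zero_mul]

lemma linearIndependent_pow_of_transcendental (hx : Transcendental K x) :
    LinearIndependent K fun n : ℕ => x ^ n := by
  have h := (basisMonomials K).linearIndependent.map' (aeval x).toLinearMap
    (LinearMap.ker_eq_bot.2 (transcendental_iff_injective.1 hx))
  simpa [Function.comp_def, aeval_monomial] using h

lemma linearIndependent_pow_mul_pow [NoZeroDivisors A] (hy : y ≠ 0)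
    (h : ∀ p : K[X], y ∣ aeval x p → p = 0) :
    LinearIndependent K fun p : ℕ × ℕ => x ^ p.1 * y ^ p.2 := by
  algebraize [(aeval (R := K) x).toRingHom]
  have : IsScalarTower K K[X] A := .of_algebraMap_eq fun c => by
    simp [RingHom.algebraMap_toAlgebra]
  have hX : LinearIndependent K fun n : ℕ => (X : K[X]) ^ n :=
    linearIndependent_pow_of_transcendental (transcendental_X K)
  have hpow : LinearIndependent K[X] fun n : ℕ => y ^ n :=
    linearIndependent_pow_of_transcendental (transcendental_of_forall_dvd_algebraMap hy h)
  simpa [Algebra.smul_def, RingHom.algebraMap_toAlgebra] using linearIndependent_smul hX hpow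

end Transcendence

section Spanning

variable {K A : Type*} [CommSemiring K] [Ring A] [Algebra K A]

lemma toSubmodule_adjoin_le_of_mul_mem {s : Set A} {M : Submodule K A} (one_mem : 1 ∈ M)
    (mul_mem : ∀ x ∈ s, ∀ y ∈ M, x * y ∈ M) : Subalgebra.toSubmodule (Algebra.adjoin K s) ≤ M := by
  rw [Algebra.adjoin_eq_span, Submodule.span_le]
  intro z hz
  induction hz using Submonoid.closure_induction_left with
  | one => exact one_mem
  | mul_left x hx y _ hy => exact mul_mem x hx y hy

lemma commutator_mem_adjoin {s : Set A} {d : A}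
    (hd : ∀ x ∈ s, d * x - x * d ∈ Algebra.adjoin K s) {c : A} (hc : c ∈ Algebra.adjoin K s) :
    d * c - c * d ∈ Algebra.adjoin K s := by
  induction hc using Algebra.adjoin_induction with
  | mem x hx => exact hd x hx
  | algebraMap r => simp [Algebra.commutes r d]
  | add a b _ _ iha ihb =>
    rw [show d * (a + b) - (a + b) * d = (d * a - a * d) + (d * b - b * d) by noncomm_ring]
    exact add_mem iha ihb
  | mul a b ha hb iha ihb =>
    rw [show d * (a * b) - a * b * d = (d * a - a * d) * b + a * (d * b - b * d) by noncomm_ring]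
    exact add_mem (mul_mem iha hb) (mul_mem ha ihb)

theorem span_range_mul_pow_eq_adjoin_insert {ι : Type*} {v : ι → A} {s : Set A} {d : A}
    (hv : Submodule.span K (Set.range v) = Subalgebra.toSubmodule (Algebra.adjoin K s))
    (hd : ∀ x ∈ s, d * x - x * d ∈ Algebra.adjoin K s) :
    Submodule.span K (Set.range fun p : ι × ℕ => v p.1 * d ^ p.2) =
      Subalgebra.toSubmodule (Algebra.adjoin K (insert d s)) := by
  set M := Submodule.span K (Set.range fun p : ι × ℕ => v p.1 * d ^ p.2)
  have v_mem (i : ι) : v i ∈ Algebra.adjoin K s := by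
    rw [← Subalgebra.mem_toSubmodule, ← hv]
    exact Submodule.subset_span ⟨i, rfl⟩
  have mul_pow_mem {c : A} (hc : c ∈ Algebra.adjoin K s) (k : ℕ) : c * d ^ k ∈ M := by
    rw [← Subalgebra.mem_toSubmodule, ← hv] at hc
    have hle : Submodule.span K (Set.range v) ≤ M.comap (LinearMap.mulRight K (d ^ k)) :=
      Submodule.span_le.2 (Set.range_subset_iff.2 fun i => Submodule.subset_span ⟨(i, k), rfl⟩)
    exact hle hc
  refine le_antisymm (Submodule.span_le.2 (Set.range_subset_iff.2 fun p => ?_))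
    (toSubmodule_adjoin_le_of_mul_mem ?_ fun x hx => ?_)
  · exact (Algebra.adjoin K (insert d s)).mul_mem
      (Algebra.adjoin_mono (Set.subset_insert d s) (v_mem p.1))
      (pow_mem (Algebra.subset_adjoin (Set.mem_insert d s)) p.2)
  · simpa using mul_pow_mem (one_mem _) 0
  · change M ≤ M.comap (LinearMap.mulLeft K x)
    refine Submodule.span_le.2 (Set.range_subset_iff.2 fun ⟨i, k⟩ => ?_)
    change x * (v i * d ^ k) ∈ M
    obtain rfl | hx := hx
    · rw [show x * (v i * x ^ k) = v i * x ^ (k + 1) + (x * v i - v i * x) * x ^ k by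
        rw [pow_succ']; noncomm_ring]
      exact add_mem (Submodule.subset_span ⟨(i, k + 1), rfl⟩)
        (mul_pow_mem (commutator_mem_adjoin hd (v_mem i)) k)
    · rw [← mul_assoc]
      exact mul_pow_mem (mul_mem (Algebra.subset_adjoin hx) (v_mem i)) k

lemma span_range_pow_eq_adjoin_singleton (x : A) :
    Submodule.span K (Set.range fun n : ℕ => x ^ n) =
      Subalgebra.toSubmodule (Algebra.adjoin K {x}) := by
  rw [Algebra.adjoin_eq_span, ← Submonoid.powers_eq_closure, Submonoid.coe_powers]

end Spanning

section Iterates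

variable {K A : Type*} [CommSemiring K] [CommSemiring A] [Algebra K A]

/-- The composite `D (k - 1) ∘ ⋯ ∘ D 0`, for `D k` the operator to apply at step `k`. -/
def iterComp (D : ℕ → Module.End K A) : ℕ → Module.End K A
  | 0 => 1
  | k + 1 => D k * iterComp D k

variable {c : K} {t : A}

lemma map_pow_succ_mul {d : Module.End K A} (hd : ∀ f, d (t * f) = c • f + t * d f) (m : ℕ)
    (f : A) : d (t ^ (m + 1) * f) = t ^ m * (((m + 1) * c) • f + t * d f) := by
  induction m with
  | zero => simp [hd]
  | succ m ih =>
    rw [pow_succ' t (m + 1), mul_assoc, hd, ih]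
    simp only [Algebra.smul_def, map_mul, map_add, map_natCast, map_one, Nat.cast_add,
      Nat.cast_one, pow_succ]
    ring

variable {D : ℕ → Module.End K A} (hD : ∀ k f, D k (t * f) = c • f + t * D k f)
  {ev : A →ₐ[K] K} (ht : ev t = 0)

include hD ht

lemma exists_iterComp_pow_mul (k m : ℕ) (f : A) :
    ∃ g, iterComp D k (t ^ (m + k) * f) = t ^ m * g ∧
      ev g = (m + k).descFactorial k * c ^ k * ev f := by
  induction k generalizing m with
  | zero => exact ⟨f, rfl, by simp⟩
  | succ k ih =>
    obtain ⟨g, hg, hev⟩ := ih (m + 1)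
    refine ⟨((m + 1) * c) • g + t * D k g, ?_, ?_⟩
    · rw [iterComp, Module.End.mul_apply, show m + (k + 1) = m + 1 + k by ring, hg,
        map_pow_succ_mul (hD k)]
    · rw [show m + (k + 1) = m + 1 + k by ring, Nat.descFactorial_succ, Nat.add_sub_cancel]
      simp only [map_add, map_smul, map_mul, hev, ht, smul_eq_mul]
      push_cast
      ring

lemma eval_iterComp_pow_of_lt {k N : ℕ} (h : k < N) : ev (iterComp D k (t ^ N)) = 0 := by
  obtain ⟨g, hg, -⟩ := exists_iterComp_pow_mul hD ht k (N - k) 1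
  rw [mul_one, Nat.sub_add_cancel h.le] at hg
  rw [hg, map_mul, map_pow, ht, zero_pow (Nat.sub_pos_of_lt h).ne', zero_mul]

lemma eval_iterComp_pow_self (k : ℕ) : ev (iterComp D k (t ^ k)) = k.factorial * c ^ k := by
  obtain ⟨g, hg, hev⟩ := exists_iterComp_pow_mul hD ht k 0 1
  simp only [mul_one, zero_add, pow_zero, one_mul, map_one, Nat.descFactorial_self] at hg hev
  rw [hg, hev]

end Iterates

theorem linearIndependent_iterComp {K A Z : Type*} [CommRing K] [IsDomain K] [CharZero K]
    [CommRing A] [Algebra K A] {D : ℕ → Module.End K A} {c : K} (hc : c ≠ 0) {t : Z → A}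
    (hD : ∀ z k f, D k (t z * f) = c • f + t z * D k f) {ev : Z → A →ₐ[K] K}
    (ht : ∀ z, ev z (t z) = 0) (hev : ∀ f, (∀ z, ev z f = 0) → f = 0) :
    LinearIndependent A (iterComp D) := by
  refine linearIndependent_iff.2 fun l hl => ?_
  by_contra hne
  have hsupp : l.support.Nonempty := Finsupp.support_nonempty_iff.2 hne
  set N := l.support.max' hsupp
  refine Finsupp.mem_support_iff.1 (l.support.max'_mem hsupp) (hev _ fun z => ?_)
  have hsum : ∑ k ∈ l.support, ev z (l k) * ev z (iterComp D k (t z ^ N)) = 0 := by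
    simpa [Finsupp.linearCombination_apply, Finsupp.sum] using
      congrArg (ev z) (LinearMap.congr_fun hl (t z ^ N))
  rw [Finset.sum_eq_single_of_mem N (l.support.max'_mem hsupp) fun k hk hkN => by
    rw [eval_iterComp_pow_of_lt (hD z) (ht z) ((l.support.le_max' k hk).lt_of_ne hkN), mul_zero],
    eval_iterComp_pow_self (hD z) (ht z)] at hsum
  exact (mul_eq_zero.1 hsum).resolve_right
    (mul_ne_zero (Nat.cast_ne_zero.2 N.factorial_ne_zero) (pow_ne_zero N hc))

open Derivative MatrixGroups ModularForm Module UpperHalfPlane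

section SerreDerivative

lemma isBoundedAtImInfty_normalizedDerivOfComplex {F : ℍ → ℂ} (hF : MDiff F)
    (hb : IsBoundedAtImInfty F) : IsBoundedAtImInfty (normalizedDerivOfComplex F) := by
  rw [isBoundedAtImInfty_iff] at hb ⊢
  obtain ⟨M, A, hMA⟩ := hb
  refine ⟨‖(2 * Real.pi * Complex.I : ℂ)⁻¹‖ * M, max A 0 + 2, fun z hz => ?_⟩
  have im_ge : ∀ w ∈ Metric.closedBall (z : ℂ) 1, 0 < w.im ∧ A ≤ w.im := fun w hw => by
    have him : |(w - z).im| ≤ 1 :=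
      (Complex.abs_im_le_norm _).trans (by simpa [dist_eq_norm] using hw)
    rw [Complex.sub_im, coe_im] at him
    constructor <;> linarith [(abs_le.1 him).1, le_max_left A 0, le_max_right A 0]
  have hdiff : DifferentiableOn ℂ (F ∘ ofComplex) (Metric.closedBall (z : ℂ) 1) :=
    (UpperHalfPlane.mdifferentiable_iff.1 hF).mono fun w hw => (im_ge w hw).1
  have cauchy : ‖deriv (F ∘ ofComplex) z‖ ≤ M / 1 := by
    refine Complex.norm_deriv_le_of_forall_mem_sphere_norm_le one_pos ?_ fun w hw => ?_
    · exact DifferentiableOn.diffContOnCl (by rwa [closure_ball _ one_ne_zero])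
    · obtain ⟨him, hA⟩ := im_ge w (Metric.sphere_subset_closedBall hw)
      rw [Function.comp_apply, ofComplex_apply_of_im_pos him]
      exact hMA ⟨w, him⟩ hA
  rw [div_one] at cauchy
  simp only [normalizedDerivOfComplex, norm_mul]
  gcongr

lemma isBoundedAtImInfty_serreDerivative (k : ℂ) {F : ℍ → ℂ} (hF : MDiff F)
    (hb : IsBoundedAtImInfty F) : IsBoundedAtImInfty (serreDerivative k F) := by
  have hE₂ : IsBoundedAtImInfty ((k * 12⁻¹) • EisensteinSeries.E2) :=
    EisensteinSeries.isBoundedAtImInfty_E2.const_smul_left _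
  exact (isBoundedAtImInfty_normalizedDerivOfComplex hF hb).sub (hE₂.mul hb)

/-- The Serre derivative of a modular form of weight `k`, as a modular form of weight `k + 2`. -/
noncomputable def serreModularForm {Γ : Subgroup (GL (Fin 2) ℝ)} [Γ.IsArithmetic] (hΓ : Γ ≤ 𝒮ℒ)
    {k : ℤ} (f : ModularForm Γ k) : ModularForm Γ (k + 2) where
  toFun := serreDerivative k f
  slash_action_eq' γ hγ := by
    obtain ⟨γ, rfl⟩ := hΓ hγ
    exact serreDerivative_slash_invariant f.holo' (f.slash_action_eq' _ hγ)
  holo' := serreDerivative_mdifferentiable _ f.holo'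
  bdd_at_cusps' hc := by
    have hcSL := (Subgroup.IsArithmetic.isCusp_iff_isCusp_SL2Z Γ).1 hc
    rw [OnePoint.isBoundedAt_iff_forall_SL2Z hcSL]
    intro γ hγ
    have hslash := serreDerivative_slash_equivariant (k := k) (γ := γ) f.holo'
    exact hslash ▸ isBoundedAtImInfty_serreDerivative k (f.holo'.slash k γ)
      ((OnePoint.isBoundedAt_iff_forall_SL2Z hcSL).1 (f.bdd_at_cusps' hc) γ hγ)

lemma exists_smul_eq_serreDerivative {k : ℤ} (f : ModularForm 𝒮ℒ k) {g : ModularForm 𝒮ℒ (k + 2)}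
    (hrank : Module.rank ℂ (ModularForm 𝒮ℒ (k + 2)) = 1) (hg : g ≠ 0) :
    ∃ c : ℂ, serreDerivative k f = c • (g : ℍ → ℂ) := by
  obtain ⟨c, hc⟩ := (finrank_eq_one_iff_of_nonzero' g hg).1
    (rank_eq_one_iff_finrank_eq_one.1 hrank) (serreModularForm le_rfl f)
  exact ⟨c, congrArg DFunLike.coe hc.symm⟩

lemma exists_serreD_E4_eq_smul : ∃ c : ℂ, serreD 4 E4 = c • E6 := by
  obtain ⟨c, hc⟩ := exists_smul_eq_serreDerivative E₄ levelOne_weight_six_rank_one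
    (EisensteinSeries.E_ne_zero (k := 6) (by norm_num) ⟨3, rfl⟩)
  exact ⟨c, Subtype.ext (by simpa using! hc)⟩

lemma exists_serreD_E6_eq_smul : ∃ c : ℂ, serreD 6 E6 = c • (E4 * E4) := by
  have hE₄ : E₄ ≠ 0 := EisensteinSeries.E_ne_zero (k := 4) (by norm_num) ⟨2, rfl⟩
  have hmul : E₄.mul E₄ ≠ 0 := fun h => hE₄ <| DFunLike.coe_injective <| or_self_iff.1 <|
    (UpperHalfPlane.mul_eq_zero_iff E₄.holo' E₄.holo').1 (congrArg DFunLike.coe h)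
  have hrank : Module.rank ℂ (ModularForm 𝒮ℒ 8) = 1 := by
    simpa [Nat.ModEq] using dimension_level_one 8 ⟨4, rfl⟩
  obtain ⟨c, hc⟩ := exists_smul_eq_serreDerivative E₆ hrank hmul
  exact ⟨c, Subtype.ext (by simpa using! hc)⟩

end SerreDerivative

section LevelOneValues

lemma slashInvariantForm_S_smul_vadd {F : Type*} [FunLike F ℍ ℂ] {k : ℤ}
    [SlashInvariantFormClass F 𝒮ℒ k] (f : F) (n : ℤ) (z : ℍ) :
    f (ModularGroup.S • ((n : ℝ) +ᵥ z)) = ((n : ℂ) + z) ^ k * f z := by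
  have hS := SlashInvariantForm.slash_action_eqn'' f
    (MonoidHom.mem_range.2 ⟨ModularGroup.S, rfl⟩ : _ ∈ 𝒮ℒ) ((n : ℝ) +ᵥ z)
  have hT : f ((n : ℝ) +ᵥ z) = f z :=
    SlashInvariantForm.vAdd_apply_of_mem_strictPeriods (Γ := 𝒮ℒ) (k := k) f z (by simp)
  rw [hT] at hS
  have hdenom : denom ModularGroup.S ((n : ℝ) +ᵥ z) = (n : ℂ) + z := by
    rw [ModularGroup.denom_S]
    simp
  exact hdenom ▸ hS

lemma E₆_apply_I : E₆ I = 0 := by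
  have hS : ModularGroup.S • I = I := by
    rw [modular_S_smul]
    ext
    simp
  have h := slashInvariantForm_S_smul_vadd E₆ 0 I
  have hI : Complex.I ^ (6 : ℤ) = -1 := by
    rw [show (6 : ℤ) = (4 : ℤ) + 2 by norm_num, zpow_add₀ Complex.I_ne_zero]
    simp [zpow_ofNat]
  rw [Int.cast_zero, zero_vadd, hS, Int.cast_zero, zero_add, coe_I, hI] at h
  linear_combination (1 / 2) * h

lemma E₄_apply_I_ne_zero : E₄ I ≠ 0 := fun h => discriminant_ne_zero I <| by
  rw [discriminant_eq_E₄_cube_sub_E₆_sq, h, E₆_apply_I]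
  norm_num

lemma infinite_setOf_eval_E₄_of_E₆_eq_zero : {w | ∃ z, E₆ z = 0 ∧ E₄ z = w}.Infinite := by
  have hpow : Set.Infinite (Set.range fun n : ℕ => ((n : ℂ) + Complex.I) ^ 4 * E₄ I) := by
    refine Set.infinite_range_of_injective fun m n hmn => ?_
    have hnorm := congrArg norm (mul_right_cancel₀ E₄_apply_I_ne_zero hmn)
    have hnormSq (j : ℕ) : ‖((j : ℂ) + Complex.I) ^ 4‖ = ((j : ℝ) ^ 2 + 1) ^ 2 := by
      rw [norm_pow, show 4 = 2 * 2 by rfl, pow_mul, Complex.sq_norm, Complex.normSq_apply]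
      simp [sq]
    simp only [hnormSq] at hnorm
    simpa using (sq_eq_sq₀ (by positivity) (by positivity)).1 hnorm
  refine hpow.mono ?_
  rintro _ ⟨n, rfl⟩
  refine ⟨ModularGroup.S • (((n : ℤ) : ℝ) +ᵥ I), ?_, ?_⟩
  · rw [slashInvariantForm_S_smul_vadd, E₆_apply_I, mul_zero]
  · rw [slashInvariantForm_S_smul_vadd, coe_I, Int.cast_natCast]
    rfl

end LevelOneValues

section HolomorphicFunctions

instance : NoZeroDivisors Hol where
  eq_zero_or_eq_zero_of_mul_eq_zero {f g} h :=
    ((UpperHalfPlane.mul_eq_zero_iff f.2 g.2).1 (congrArg Subtype.val h)).imp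
      Subtype.ext Subtype.ext

/-- Evaluation of holomorphic functions at `z`. -/
noncomputable def evalAt (z : ℍ) : Hol →ₐ[ℂ] ℂ := (Pi.evalAlgHom ℂ (fun _ => ℂ) z).comp Hol.val

theorem linearIndependent_E4_pow_mul_E6_pow :
    LinearIndependent ℂ fun p : ℕ × ℕ => E4 ^ p.1 * E6 ^ p.2 := by
  have hE6 : E6 ≠ 0 := fun h =>
    EisensteinSeries.E_ne_zero (k := 6) (by norm_num) ⟨3, rfl⟩
      (DFunLike.coe_injective (congrArg Subtype.val h))
  refine linearIndependent_pow_mul_pow hE6 fun p ⟨g, hg⟩ => ?_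
  refine eq_zero_of_infinite_isRoot p (infinite_setOf_eval_E₄_of_E₆_eq_zero.mono ?_)
  rintro _ ⟨z, hz, rfl⟩
  have hE6z : evalAt z E6 = 0 := hz
  calc p.eval (evalAt z E4) = evalAt z (aeval E4 p) := by
        rw [← aeval_algHom_apply, coe_aeval_eq_eval]
    _ = 0 := by rw [hg, map_mul, hE6z, zero_mul]

lemma serreD_mul (m n : ℝ) (f g : Hol) :
    serreD (m + n) (f * g) = serreD m f * g + f * serreD n g := by
  have h := serreDerivative_mul m n f.1 g.1 f.2 g.2
  rw [← Complex.ofReal_add] at h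
  exact Subtype.ext h

/-- The coordinate `z - z₀` centred at `z₀`. -/
noncomputable def subPt (z₀ : ℍ) : Hol :=
  ⟨fun z => (z : ℂ) - z₀, mdifferentiable_coe.sub mdifferentiable_const⟩

lemma evalAt_subPt_self (z₀ : ℍ) : evalAt z₀ (subPt z₀) = 0 := sub_self (z₀ : ℂ)

lemma serreD_zero_subPt (z₀ : ℍ) :
    serreD 0 (subPt z₀) = (2 * Real.pi * Complex.I : ℂ)⁻¹ • 1 := by
  refine Subtype.ext (funext fun z => ?_)
  have hext : (subPt z₀).1 ∘ ofComplex =ᶠ[nhds (z : ℂ)] fun w => w - z₀ := by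
    filter_upwards [isOpen_upperHalfPlaneSet.mem_nhds z.im_pos] with w hw
    simp [subPt, ofComplex_apply_of_im_pos hw]
  have hderiv : deriv ((subPt z₀).1 ∘ ofComplex) z = 1 := by
    rw [hext.deriv_eq]
    simp
  simp [serreD, normalizedDerivOfComplex, hderiv]

lemma serreD_subPt_mul (z₀ : ℍ) (n : ℝ) (f : Hol) :
    serreD n (subPt z₀ * f) = (2 * Real.pi * Complex.I : ℂ)⁻¹ • f + subPt z₀ * serreD n f := by
  have h := serreD_mul 0 n (subPt z₀) f
  rwa [zero_add, serreD_zero_subPt, smul_one_mul] at h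

/-- The iterated Serre derivative `D_{n+2k-2} ∘ ⋯ ∘ D_{n+2} ∘ D_n`, which is how `δ ^ k` acts
on `H_n`. -/
noncomputable def serreIter (n : ℝ) : ℕ → Module.End ℂ Hol := iterComp fun k => serreD (n + 2 * k)

theorem linearIndependent_serreIter (n : ℝ) : LinearIndependent Hol (serreIter n) :=
  linearIndependent_iterComp (inv_ne_zero Complex.two_pi_I_ne_zero)
    (fun z₀ k => serreD_subPt_mul z₀ (n + 2 * k)) evalAt_subPt_self
    fun _ h => Subtype.ext (funext h)

end HolomorphicFunctions

section Operators

lemma EndH.hom_ext {φ ψ : EndH}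
    (h : ∀ n f, (φ : Module.End ℂ H) (inc n f) = (ψ : Module.End ℂ H) (inc n f)) : φ = ψ :=
  Subtype.ext (MLDO.hom_ext h)

lemma delta_inc (n : ℝ) (f : Hol) :
    (delta : Module.End ℂ H) (inc n f) = inc (n + 2) (serreD n f) :=
  shiftMap_inc 2 serreD n f

/-- The operator `(f, n) ↦ (g f, n + w)` of multiplication by `g`, viewed as having weight `w`;
both `e₄` and `e₆` are of this form. -/
noncomputable def mulEnd (w : ℝ) : Hol →ₗ[ℂ] EndH where
  toFun g := ⟨shiftMap w fun _ => LinearMap.mulLeft ℂ g, mem_EndH (shiftMap_mem w _)⟩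
  map_add' g h := EndH.hom_ext fun n f => by simp [shiftMap_inc, add_mul]
  map_smul' c g := EndH.hom_ext fun n f => by simp [shiftMap_inc]

lemma mulEnd_inc (w : ℝ) (g : Hol) (n : ℝ) (f : Hol) :
    (mulEnd w g : Module.End ℂ H) (inc n f) = inc (n + w) (g * f) :=
  shiftMap_inc w _ n f

lemma mulEnd_zero_one : mulEnd 0 1 = 1 := EndH.hom_ext fun n f => by simp [mulEnd_inc]

lemma mulEnd_mul_mulEnd (v w : ℝ) (g h : Hol) :
    mulEnd v g * mulEnd w h = mulEnd (v + w) (g * h) := EndH.hom_ext fun n f => by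
  rw [MulMemClass.coe_mul, Module.End.mul_apply, mulEnd_inc, mulEnd_inc, mulEnd_inc, mul_assoc,
    add_assoc, add_comm w v]

lemma mulEnd_pow (w : ℝ) (g : Hol) (i : ℕ) : mulEnd w g ^ i = mulEnd (i * w) (g ^ i) := by
  induction i with
  | zero => simp [mulEnd_zero_one]
  | succ i ih => rw [pow_succ, ih, mulEnd_mul_mulEnd, pow_succ, Nat.cast_succ, add_one_mul]

lemma delta_mul_mulEnd_sub (w : ℝ) (g : Hol) :
    delta * mulEnd w g - mulEnd w g * delta = mulEnd (w + 2) (serreD w g) :=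
  EndH.hom_ext fun n f => by
    have hleft : ((delta * mulEnd w g : EndH) : Module.End ℂ H) (inc n f) =
        inc (n + (w + 2)) (serreD (w + n) (g * f)) := by
      rw [MulMemClass.coe_mul, Module.End.mul_apply, mulEnd_inc, delta_inc, add_assoc, add_comm n w]
    have hright : ((mulEnd w g * delta : EndH) : Module.End ℂ H) (inc n f) =
        inc (n + (w + 2)) (g * serreD n f) := by
      rw [MulMemClass.coe_mul, Module.End.mul_apply, delta_inc, mulEnd_inc, add_assoc, add_comm 2 w]
    rw [AddSubgroupClass.coe_sub, LinearMap.sub_apply, hleft, hright, mulEnd_inc, ← map_sub,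
      serreD_mul, add_sub_cancel_right]

lemma exists_delta_mul_e4_sub_eq_smul : ∃ c : ℂ, delta * e4 - e4 * delta = c • e6 := by
  obtain ⟨c, hc⟩ := exists_serreD_E4_eq_smul
  refine ⟨c, (delta_mul_mulEnd_sub 4 E4).trans ?_⟩
  rw [hc, map_smul, show (4 : ℝ) + 2 = 6 by norm_num]
  rfl

lemma exists_delta_mul_e6_sub_eq_smul : ∃ c : ℂ, delta * e6 - e6 * delta = c • (e4 * e4) := by
  obtain ⟨c, hc⟩ := exists_serreD_E6_eq_smul
  refine ⟨c, (delta_mul_mulEnd_sub 6 E6).trans ?_⟩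
  rw [hc, map_smul, show (6 : ℝ) + 2 = 4 + 4 by norm_num, ← mulEnd_mul_mulEnd]
  rfl

lemma commute_e6_e4 : Commute e6 e4 :=
  (mulEnd_mul_mulEnd 6 4 E6 E4).trans <| by
    rw [add_comm, mul_comm, ← mulEnd_mul_mulEnd]
    rfl

theorem span_range_e4_pow_mul_e6_pow_mul_delta_pow :
    Submodule.span ℂ (Set.range fun p : (ℕ × ℕ) × ℕ => e4 ^ p.1.1 * e6 ^ p.1.2 * delta ^ p.2) =
      Subalgebra.toSubmodule R := by
  have he4 : e4 ∈ Algebra.adjoin ℂ {e6, e4} := Algebra.subset_adjoin (by simp)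
  have he6 : e6 ∈ Algebra.adjoin ℂ {e6, e4} := Algebra.subset_adjoin (by simp)
  have hspan := span_range_mul_pow_eq_adjoin_insert (d := e6)
    (span_range_pow_eq_adjoin_singleton (K := ℂ) e4) <| by
      rintro _ rfl
      simp [commute_e6_e4.eq]
  rw [R, Set.pair_comm, span_range_mul_pow_eq_adjoin_insert hspan]
  rintro _ (rfl | rfl)
  · obtain ⟨c, hc⟩ := exists_delta_mul_e6_sub_eq_smul
    exact hc ▸ Subalgebra.smul_mem _ (mul_mem he4 he4) c
  · obtain ⟨c, hc⟩ := exists_delta_mul_e4_sub_eq_smul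
    exact hc ▸ Subalgebra.smul_mem _ he6 c

lemma delta_pow_inc (k : ℕ) (n : ℝ) (f : Hol) :
    ((delta ^ k : EndH) : Module.End ℂ H) (inc n f) = inc (n + 2 * k) (serreIter n k f) := by
  induction k with
  | zero => simp [serreIter, iterComp]
  | succ k ih =>
    rw [pow_succ', MulMemClass.coe_mul, Module.End.mul_apply, ih, delta_inc, Nat.cast_succ,
      mul_add_one, ← add_assoc]
    rfl

/-- The operator on `Hol` by which an element of `End(H)` acts on `H_n`, forgetting the weights
in its target. -/
noncomputable def actionAt (n : ℝ) : EndH →ₗ[ℂ] Module.End ℂ Hol where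
  toFun φ := liftH (fun _ => LinearMap.id) ∘ₗ (φ : Module.End ℂ H) ∘ₗ inc n
  map_add' φ ψ := LinearMap.ext fun f => by simp
  map_smul' c φ := LinearMap.ext fun f => by simp

lemma actionAt_mulEnd_mul_delta_pow (n w : ℝ) (g : Hol) (k : ℕ) :
    actionAt n (mulEnd w g * delta ^ k) = g • serreIter n k := LinearMap.ext fun f => by
  simp [actionAt, -SubmonoidClass.coe_pow, delta_pow_inc, mulEnd_inc]

theorem linearIndependent_e4_pow_mul_e6_pow_mul_delta_pow :
    LinearIndependent ℂ fun p : (ℕ × ℕ) × ℕ => e4 ^ p.1.1 * e6 ^ p.1.2 * delta ^ p.2 := by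
  refine LinearIndependent.of_comp (actionAt 0) ?_
  convert linearIndependent_smul linearIndependent_E4_pow_mul_E6_pow (linearIndependent_serreIter 0)
    using 2 with p
  rw [Function.comp_apply, show e4 = mulEnd 4 E4 from rfl, show e6 = mulEnd 6 E6 from rfl,
    mulEnd_pow, mulEnd_pow, mulEnd_mul_mulEnd, actionAt_mulEnd_mul_delta_pow]

end Operators

end MLDO

theorem mainTheorem3 :
    ∃ b : Module.Basis (ℕ × ℕ × ℕ) ℂ MLDO.R, ∀ i j k : ℕ,
      (b (i, j, k) : MLDO.EndH) = MLDO.e4 ^ i * MLDO.e6 ^ j * MLDO.delta ^ k := by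
  have hli := MLDO.linearIndependent_e4_pow_mul_e6_pow_mul_delta_pow
  have hspan := MLDO.span_range_e4_pow_mul_e6_pow_mul_delta_pow
  let basisR := (Module.Basis.span hli).map (LinearEquiv.ofEq _ _ hspan ≪≫ₗ MLDO.R.toSubmoduleEquiv)
  refine ⟨basisR.reindex (Equiv.prodAssoc ℕ ℕ ℕ), fun i j k => ?_⟩
  rw [Module.Basis.reindex_apply, Module.Basis.map_apply]
  exact Module.Basis.coe_span_apply hli ((i, j), k)
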